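/- Let the actions be $\mathcal{A}_\tau=\{a,\bar a,\tau\}$ (with $\bar{\bar a}=a$), and let $\mathrm{CCS}_f$ be the language of terms \[ t ::= \mathbf 0 \mid x \mid \mu.t \mid t+t \mid t\parallel t \mid f(t,t) \qquad (\mu\in\mathcal{A}_\tau,\ x \text{ a variable}), \] where prefixing, $+$ and $\parallel$ have their usual CCS transition rules (with communication: if $x\xrightarrow{\beta}x'$ and $y\xrightarrow{\bar\beta}y'$ for some $\beta\in\{a,\bar a\}$, then $x\parallel y\xrightarrow{\tau}x'\parallel y'$). Fix $\alpha\in\{a,\bar a\}$ and a set $C\subseteq\{a,\bar a\}$ with $\alpha\in C$, and let the rules for the binary operator $f$ be \[ \frac{x\xrightarrow{\mu}x'}{f(x,y)\xrightarrow{\mu}x'\parallel y}\ (\mu\in\mathcal{A}_\tau), \qquad \frac{x\xrightarrow{\beta}x'\quad y\xrightarrow{\bar\beta}y'}{f(x,y)\xrightarrow{\tau}x'\parallel y'}\ (\beta\in C). \] Write $\sim$ for bisimilarity of closed terms. An equation $t\approx u$ is sound if $\sigma(t)\sim\sigma(u)$ for every closed substitution $\sigma$, and $\mathcal{E}\vdash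 t\approx u$ denotes derivability in equational logic, terms being considered modulo associativity and commutativity of $+$. The size of a term is its number of operator symbols, the constant $\mathbf 0$ not being counted. The summands of a term $t=t_1+\dots+t_k$, where no $t_i$ has $+$ as its head operator, are $t_1,\dots,t_k$. Let $\mu^0=\mathbf 0$, $\mu^{m+1}=\mu.\mu^m$ and $\mu^{\le i}=\mu+\mu^2+\dots+\mu^i$ (an empty sum being $\mathbf 0$), and for $n\ge 0$ let \[ p_n=\sum_{i=0}^n\bar\alpha.\alpha^{\le i}, \qquad \epsilon_n:\quad f(\alpha.\mathbf 0,p_n)\approx\alpha.p_n+\sum_{i=0}^n\tau.\alpha^{\le i}. \] **Theorem.** Let $\mathcal{E}$ be a finite axiom system over $\mathrm{CCS}_f$ that is sound modulo bisimilarity, and let $n$ be larger than the size of each term in the equations in $\mathcal{E}$. 1. Let $p,q$ be closed terms such that $p\sim f(\alpha.\mathbf 0,p_n)$, $q\sim f(\alpha.\mathbf 0,p_n)$ and $\mathcal{E}\vdash p\approx q$. If $p$ has a summand that is bisimilar to $f(\alpha.\mathbf 0,p_n)$ and is not of the form $r\parallel s$ or $f(r,s)$ with $r\sim\mathbf 0$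 or $s\sim\mathbf 0$, then $q$ has a summand bisimilar to $f(\alpha.\mathbf 0,p_n)$. 2. The equation $\epsilon_n$ is sound modulo bisimilarity, and $\mathcal{E}\not\vdash\epsilon_n$. -/

import Mathlib

/-- The names `a` and `ā`. -/
inductive Name where
  | a : Name
  | abar : Name

/-- The complement of a name. -/
def Name.co : Name → Name
  | .a => .abar
  | .abar => .a

/-- The actions `a`, `ā`, `τ`. -/
inductive Act where
  | vis : Name → Act
  | tau : Act

/-- The terms of `CCS_f` with variables in `V`. -/
inductive Term (V : Type) where
  | zero : Term V
  | var : V → Term V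
  | pre : Act → Term V → Term V
  | plus : Term V → Term V → Term V
  | par : Term V → Term V → Term V
  | f : Term V → Term V → Term V

/-- The processes, that is, the closed terms. -/
abbrev Proc := Term Empty

namespace Term

/-- Simultaneous substitution. It is a closed substitution when `W = Empty`. -/
def subst {V W : Type} (σ : V → Term W) : Term V → Term W
  | zero => zero
  | var x => σ x
  | pre μ t => pre μ (t.subst σ)
  | plus t u => plus (t.subst σ) (u.subst σ)
  | par t u => par (t.subst σ) (u.subst σ)
  | f t u => f (t.subst σ) (u.subst σ)

/-- A closed term regarded as a term over the variables in `V`. -/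
def lift {V : Type} (p : Proc) : Term V := p.subst (fun x => x.elim)

/-- The number of operator symbols of a term (the constant `0` is not counted). -/
def size {V : Type} : Term V → ℕ
  | zero => 0
  | var _ => 0
  | pre _ t => t.size + 1
  | plus t u => t.size + u.size + 1
  | par t u => t.size + u.size + 1
  | f t u => t.size + u.size + 1

/-- The summands of a term: writing it as `t₁ + ⋯ + t_k` with no `t_i` having `+` as its head
operator, these are the terms `t_i`. -/
def summands {V : Type} : Term V → Set (Term V)
  | zero => {zero}
  | var x => {var x}
  | pre μ t => {pre μ t}
  | plus t u => t.summands ∪ u.summands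
  | par t u => {par t u}
  | f t u => {f t u}

/-- Finite summation; the empty sum is `0`. -/
def sum {V : Type} : List (Term V) → Term V
  | [] => zero
  | [t] => t
  | t :: u :: l => plus t (sum (u :: l))

/-- `μ^m`: `m` nested prefixes `μ` in front of `0`. -/
def pow {V : Type} (μ : Act) : ℕ → Term V
  | 0 => zero
  | m + 1 => pre μ (pow μ m)

/-- `μ^{≤ i} = μ + μ² + ⋯ + μ^i`. -/
def powLE {V : Type} (μ : Act) (i : ℕ) : Term V :=
  sum ((List.range i).map fun j => pow μ (j + 1))

/-- `p_n = ∑_{i=0}^n ᾱ α^{≤ i}`. -/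
def pn {V : Type} (α : Name) (n : ℕ) : Term V :=
  sum ((List.range (n + 1)).map fun i => pre (.vis α.co) (powLE (.vis α) i))

/-- The term `f(α, p_n)`, the left-hand side of `ε_n`. -/
def epsLeft {V : Type} (α : Name) (n : ℕ) : Term V :=
  f (pre (.vis α) zero) (pn α n)

/-- The term `α p_n + ∑_{i=0}^n τ α^{≤ i}`, the right-hand side of `ε_n`. -/
def epsRight {V : Type} (α : Name) (n : ℕ) : Term V :=
  plus (pre (.vis α) (pn α n))
    (sum ((List.range (n + 1)).map fun i => pre .tau (powLE (.vis α) i)))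

end Term

/-- The transitions between closed terms that are provable from the SOS rules. The set `C` consists
of the names `β` for which `f` has the communication rule
`x -β→ x', y -β̄→ y' ⟹ f(x, y) -τ→ x' ∥ y'`. -/
inductive Step (C : Set Name) : Proc → Act → Proc → Prop where
  | pre (μ : Act) (p : Proc) : Step C (.pre μ p) μ p
  | plusLeft {p p' : Proc} {μ : Act} (q : Proc) :
      Step C p μ p' → Step C (.plus p q) μ p'
  | plusRight {q q' : Proc} {μ : Act} (p : Proc) :
      Step C q μ q' → Step C (.plus p q) μ q'
  | parLeft {p p' : Proc} {μ : Act} (q : Proc) :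
      Step C p μ p' → Step C (.par p q) μ (.par p' q)
  | parRight {q q' : Proc} {μ : Act} (p : Proc) :
      Step C q μ q' → Step C (.par p q) μ (.par p q')
  | parComm {p p' q q' : Proc} {β : Name} :
      Step C p (.vis β) p' → Step C q (.vis β.co) q' → Step C (.par p q) .tau (.par p' q')
  | fLeft {p p' : Proc} {μ : Act} (q : Proc) :
      Step C p μ p' → Step C (.f p q) μ (.par p' q)
  | fComm {p p' q q' : Proc} {β : Name} : β ∈ C →
      Step C p (.vis β) p' → Step C q (.vis β.co) q' → Step C (.f p q) .tau (.par p' q')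

/-- Bisimilarity: the union of all bisimulations, that is, the largest one. -/
def Bisim (C : Set Name) (p q : Proc) : Prop :=
  ∃ R : Proc → Proc → Prop, (∀ r s, R r s → R s r) ∧
    (∀ r s μ r', R r s → Step C r μ r' → ∃ s', Step C s μ s' ∧ R r' s') ∧ R p q

/-- The equation `t ≈ u` is sound modulo bisimilarity. -/
def SoundEq (C : Set Name) (t u : Term ℕ) : Prop :=
  ∀ σ : ℕ → Proc, Bisim C (t.subst σ) (u.subst σ)

/-- Derivability in equational logic from the axiom system `E`. Terms are considered modulo
commutativity and associativity of `+`, whence the last two rules. -/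
inductive Derives (E : Set (Term ℕ × Term ℕ)) : Term ℕ → Term ℕ → Prop where
  | ax {t u : Term ℕ} : (t, u) ∈ E → Derives E t u
  | refl (t : Term ℕ) : Derives E t t
  | symm {t u : Term ℕ} : Derives E t u → Derives E u t
  | trans {t u v : Term ℕ} : Derives E t u → Derives E u v → Derives E t v
  | subst {t u : Term ℕ} (σ : ℕ → Term ℕ) :
      Derives E t u → Derives E (t.subst σ) (u.subst σ)
  | pre {t u : Term ℕ} (μ : Act) : Derives E t u → Derives E (.pre μ t) (.pre μ u)
  | plus {t u t' u' : Term ℕ} :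
      Derives E t u → Derives E t' u' → Derives E (.plus t t') (.plus u u')
  | par {t u t' u' : Term ℕ} :
      Derives E t u → Derives E t' u' → Derives E (.par t t') (.par u u')
  | f {t u t' u' : Term ℕ} :
      Derives E t u → Derives E t' u' → Derives E (.f t t') (.f u u')
  | comm (t u : Term ℕ) : Derives E (.plus t u) (.plus u t)
  | assoc (t u v : Term ℕ) : Derives E (.plus (.plus t u) v) (.plus t (.plus u v))

/-- The term is a parallel composition `r ∥ s`, or a term `f(r, s)`, one of whose two arguments is
bisimilar to `0`. -/
def HasZeroFactor (C : Set Name) : Proc → Prop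
  | .par r s => Bisim C r .zero ∨ Bisim C s .zero
  | .f r s => Bisim C r .zero ∨ Bisim C s .zero
  | _ => False

/-! The proof isolates an invariant, `Exposes`: up to parallel components and right arguments of `f`
that are dead, some summand is literally an application `f(r, s)` with `r ~ α` and `s ~ p_n`. The
left-hand side of `ε_n` has it. The right-hand side, a sum of prefixes, does not. So it suffices
that derivations preserve it among closed instances bisimilar to `f(α, p_n)` (`Derives.preserves`).
Since the invariant asks for bisimilarity at its leaves, closure under the congruence rules is easy.
The weight lies on the axioms (`SoundEq.exposes`).

Let `t ≈ u` be sound with `t` small, `u σ ~ f(α, p_n)`, and let `t σ` satisfy the invariant. It is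
made observable by adding a summand to `σ y` for a suitable variable `y` (`Exposes.exists_var`). If
the exposed application lies inside `σ y`, the summand `ᾱ` gives `t` an `ᾱ`-step to a dead process.
Otherwise `t` itself contains `f(t₁, t₂)` with `t₂ σ ~ p_n`. The `n + 1` pairwise inequivalent
`ᾱ`-derivatives of `p_n` outnumber what the operators of `t₂` can supply, so a variable `y` of `t₂`
contributes to them (`exists_contributing_var`), and the summand `ᾱ.ᾱ` gives `t` a `τ`-step to a
process bisimilar to `ᾱ`.

By soundness `u` makes a matching step under the modified substitution. Without the extra summand `u
σ` cannot: it has no `ᾱ`-steps, and its `τ`-derivatives are of the form `α^{≤ i}`. Tracing the step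
back through `u σ` yields the invariant there (`Enlarges.exposes_of_step_dead`,
`Enlarges.exposes_of_step_tau`). Throughout, `p_n` and `α^{≤ i}` are indecomposable for `∥`, because
each is dead or can terminate in one visible step. -/

variable {C : Set Name} {α : Name}

/-! ### Bisimilarity -/

namespace Bisim

theorem refl (p : Proc) : Bisim C p p :=
  ⟨Eq, fun _ _ h => h.symm, fun _ _ _ r' h hs => ⟨r', h ▸ hs, rfl⟩, rfl⟩

theorem symm {p q : Proc} (h : Bisim C p q) : Bisim C q p := by
  obtain ⟨R, hR, hs, h⟩ := h
  exact ⟨R, hR, hs, hR _ _ h⟩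

theorem step {p q p' : Proc} {μ : Act} (h : Bisim C p q) (hp : Step C p μ p') :
    ∃ q', Step C q μ q' ∧ Bisim C p' q' := by
  obtain ⟨R, hR, hs, h⟩ := h
  obtain ⟨q', hq, hr⟩ := hs _ _ _ _ h hp
  exact ⟨q', hq, R, hR, hs, hr⟩

/-- A relation whose two directions are simulations is contained in bisimilarity. -/
theorem of_rel (R : Proc → Proc → Prop)
    (hl : ∀ p q μ p', R p q → Step C p μ p' → ∃ q', Step C q μ q' ∧ R p' q')
    (hr : ∀ p q μ q', R p q → Step C q μ q' → ∃ p', Step C p μ p' ∧ R p' q')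
    {p q : Proc} (h : R p q) : Bisim C p q := by
  refine ⟨fun r s => R r s ∨ R s r, fun _ _ h => h.symm, ?_, .inl h⟩
  rintro r s μ r' (h | h) hs
  · obtain ⟨s', h1, h2⟩ := hl _ _ _ _ h hs
    exact ⟨s', h1, .inl h2⟩
  · obtain ⟨s', h1, h2⟩ := hr _ _ _ _ h hs
    exact ⟨s', h1, .inr h2⟩

theorem trans {p q r : Proc} (h1 : Bisim C p q) (h2 : Bisim C q r) : Bisim C p r := by
  refine of_rel (fun p r => ∃ q, Bisim C p q ∧ Bisim C q r) ?_ ?_ ⟨q, h1, h2⟩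
  · rintro p r μ p' ⟨q, h1, h2⟩ hs
    obtain ⟨q', hq, h1'⟩ := h1.step hs
    obtain ⟨r', hr, h2'⟩ := h2.step hq
    exact ⟨r', hr, q', h1', h2'⟩
  · rintro p r μ r' ⟨q, h1, h2⟩ hs
    obtain ⟨q', hq, h2'⟩ := h2.symm.step hs
    obtain ⟨p', hp, h1'⟩ := h1.symm.step hq
    exact ⟨p', hp, q', h1'.symm, h2'.symm⟩

theorem of_steps {p q : Proc}
    (hl : ∀ μ p', Step C p μ p' → ∃ q', Step C q μ q' ∧ Bisim C p' q')
    (hr : ∀ μ q', Step C q μ q' → ∃ p', Step C p μ p' ∧ Bisim C p' q') : Bisim C p q := by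
  refine of_rel (fun r s => Bisim C r s ∨ (r = p ∧ s = q)) ?_ ?_ (.inr ⟨rfl, rfl⟩)
  · rintro r s μ r' (h | ⟨rfl, rfl⟩) hs
    · obtain ⟨s', h1, h2⟩ := h.step hs
      exact ⟨s', h1, .inl h2⟩
    · obtain ⟨s', h1, h2⟩ := hl _ _ hs
      exact ⟨s', h1, .inl h2⟩
  · rintro r s μ s' (h | ⟨rfl, rfl⟩) hs
    · obtain ⟨r', h1, h2⟩ := h.symm.step hs
      exact ⟨r', h1, .inl h2.symm⟩
    · obtain ⟨r', h1, h2⟩ := hr _ _ hs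
      exact ⟨r', h1, .inl h2⟩

theorem pre {p q : Proc} (μ : Act) (h : Bisim C p q) : Bisim C (.pre μ p) (.pre μ q) := by
  refine of_steps ?_ ?_
  · rintro _ _ ⟨⟩
    exact ⟨q, .pre _ _, h⟩
  · rintro _ _ ⟨⟩
    exact ⟨p, .pre _ _, h⟩

theorem plus {p q p' q' : Proc} (h : Bisim C p q) (h' : Bisim C p' q') :
    Bisim C (.plus p p') (.plus q q') := by
  have key : ∀ {p q p' q' : Proc}, Bisim C p q → Bisim C p' q' → ∀ μ r,
      Step C (.plus p p') μ r → ∃ s, Step C (.plus q q') μ s ∧ Bisim C r s := by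
    intro p q p' q' h h' μ r hs
    cases hs with
    | plusLeft _ hs =>
      obtain ⟨s, h1, h2⟩ := h.step hs
      exact ⟨s, .plusLeft _ h1, h2⟩
    | plusRight _ hs =>
      obtain ⟨s, h1, h2⟩ := h'.step hs
      exact ⟨s, .plusRight _ h1, h2⟩
  refine of_steps (key h h') fun μ r hs => ?_
  obtain ⟨s, h1, h2⟩ := key h.symm h'.symm μ r hs
  exact ⟨s, h1, h2.symm⟩

theorem par {p q p' q' : Proc} (h : Bisim C p q) (h' : Bisim C p' q') :
    Bisim C (.par p p') (.par q q') := by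
  refine ⟨fun r s => ∃ p q p' q', Bisim C p q ∧ Bisim C p' q' ∧ r = .par p p' ∧ s = .par q q',
    ?_, ?_, p, q, p', q', h, h', rfl, rfl⟩
  · rintro _ _ ⟨p, q, p', q', h, h', rfl, rfl⟩
    exact ⟨q, p, q', p', h.symm, h'.symm, rfl, rfl⟩
  · rintro _ _ μ r ⟨p, q, p', q', h, h', rfl, rfl⟩ hs
    cases hs with
    | parLeft _ hs =>
      obtain ⟨s, h1, h2⟩ := h.step hs
      exact ⟨_, .parLeft _ h1, _, _, _, _, h2, h', rfl, rfl⟩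
    | parRight _ hs =>
      obtain ⟨s, h1, h2⟩ := h'.step hs
      exact ⟨_, .parRight _ h1, _, _, _, _, h, h2, rfl, rfl⟩
    | parComm hs hs' =>
      obtain ⟨s, h1, h2⟩ := h.step hs
      obtain ⟨s', h1', h2'⟩ := h'.step hs'
      exact ⟨_, .parComm h1 h1', _, _, _, _, h2, h2', rfl, rfl⟩

theorem f {p q p' q' : Proc} (h : Bisim C p q) (h' : Bisim C p' q') :
    Bisim C (.f p p') (.f q q') := by
  have key : ∀ {p q p' q' : Proc}, Bisim C p q → Bisim C p' q' → ∀ μ r,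
      Step C (.f p p') μ r → ∃ s, Step C (.f q q') μ s ∧ Bisim C r s := by
    intro p q p' q' h h' μ r hs
    cases hs with
    | fLeft _ hs =>
      obtain ⟨s, h1, h2⟩ := h.step hs
      exact ⟨_, .fLeft _ h1, h2.par h'⟩
    | fComm hβ hs hs' =>
      obtain ⟨s, h1, h2⟩ := h.step hs
      obtain ⟨s', h1', h2'⟩ := h'.step hs'
      exact ⟨_, .fComm hβ h1 h1', h2.par h2'⟩
  refine of_steps (key h h') fun μ r hs => ?_
  obtain ⟨s, h1, h2⟩ := key h.symm h'.symm μ r hs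
  exact ⟨s, h1, h2.symm⟩

end Bisim

/-! ### Processes without transitions -/

/-- The process has no transitions. -/
def Dead (C : Set Name) (p : Proc) : Prop := ∀ μ r, ¬ Step C p μ r

theorem dead_zero : Dead C .zero := by rintro _ _ ⟨⟩

theorem not_dead_of_step {p r : Proc} {μ : Act} (h : Step C p μ r) : ¬ Dead C p :=
  fun hd => hd _ _ h

theorem Dead.of_bisim {p q : Proc} (hq : Dead C q) (h : Bisim C p q) : Dead C p := by
  intro μ r hs
  obtain ⟨_, h1, _⟩ := h.step hs
  exact hq _ _ h1

theorem bisim_zero_iff {p : Proc} : Bisim C p .zero ↔ Dead C p :=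
  ⟨dead_zero.of_bisim, fun h => .of_steps (fun _ _ hs => (h _ _ hs).elim)
    fun _ _ hs => (dead_zero _ _ hs).elim⟩

theorem Dead.bisim_zero {p : Proc} (h : Dead C p) : Bisim C p .zero := bisim_zero_iff.2 h

theorem dead_plus {p q : Proc} : Dead C (.plus p q) ↔ Dead C p ∧ Dead C q := by
  refine ⟨fun h => ⟨fun _ _ hs => h _ _ (.plusLeft _ hs), fun _ _ hs => h _ _ (.plusRight _ hs)⟩, ?_⟩
  rintro ⟨hp, hq⟩ _ _ hs
  cases hs with
  | plusLeft _ hs => exact hp _ _ hs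
  | plusRight _ hs => exact hq _ _ hs

theorem dead_par {p q : Proc} : Dead C (.par p q) ↔ Dead C p ∧ Dead C q := by
  refine ⟨fun h => ⟨fun _ _ hs => h _ _ (.parLeft _ hs), fun _ _ hs => h _ _ (.parRight _ hs)⟩, ?_⟩
  rintro ⟨hp, hq⟩ _ _ hs
  cases hs with
  | parLeft _ hs => exact hp _ _ hs
  | parRight _ hs => exact hq _ _ hs
  | parComm hs _ => exact hp _ _ hs

/-- The right argument of `f` moves only jointly with the left one. -/
theorem dead_f {p q : Proc} : Dead C (.f p q) ↔ Dead C p := by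
  refine ⟨fun h _ _ hs => h _ _ (.fLeft _ hs), ?_⟩
  rintro hp _ _ hs
  cases hs with
  | fLeft _ hs => exact hp _ _ hs
  | fComm _ hs _ => exact hp _ _ hs

theorem bisim_par_right {p q : Proc} (hp : Dead C p) : Bisim C (.par p q) q := by
  refine .of_rel (fun r s => ∃ p, Dead C p ∧ r = .par p s) ?_ ?_ ⟨p, hp, rfl⟩
  · rintro _ q μ r ⟨p, hp, rfl⟩ hs
    cases hs with
    | parLeft _ hs => exact (hp _ _ hs).elim
    | parRight _ hs => exact ⟨_, hs, p, hp, rfl⟩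
    | parComm hs _ => exact (hp _ _ hs).elim
  · rintro _ q μ r ⟨p, hp, rfl⟩ hs
    exact ⟨_, .parRight _ hs, p, hp, rfl⟩

theorem bisim_par_left {p q : Proc} (hq : Dead C q) : Bisim C (.par p q) p := by
  refine .of_rel (fun r s => ∃ q, Dead C q ∧ r = .par s q) ?_ ?_ ⟨q, hq, rfl⟩
  · rintro _ p μ r ⟨q, hq, rfl⟩ hs
    cases hs with
    | parLeft _ hs => exact ⟨_, hs, q, hq, rfl⟩
    | parRight _ hs => exact (hq _ _ hs).elim
    | parComm _ hs => exact (hq _ _ hs).elim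
  · rintro _ p μ r ⟨q, hq, rfl⟩ hs
    exact ⟨_, .parLeft _ hs, q, hq, rfl⟩

theorem bisim_f_left {p q : Proc} (hq : Dead C q) : Bisim C (.f p q) p := by
  refine .of_steps ?_ ?_
  · intro μ r hs
    cases hs with
    | fLeft _ hs => exact ⟨_, hs, bisim_par_left hq⟩
    | fComm _ _ hs => exact (hq _ _ hs).elim
  · intro μ r hs
    exact ⟨_, .fLeft _ hs, bisim_par_left hq⟩

/-- A process that can terminate in one visible step has no decomposition in two parallel
components that are both alive. -/
theorem dead_or_dead_of_par_bisim {p q r s : Proc} {β : Name} (hs : Step C p (.vis β) s)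
    (hd : Dead C s) (h : Bisim C (.par q r) p) : Dead C q ∨ Dead C r := by
  obtain ⟨t, ht, hst⟩ := h.symm.step hs
  have := hd.of_bisim hst.symm
  cases ht with
  | parLeft _ _ => exact .inr (dead_par.1 this).2
  | parRight _ _ => exact .inl (dead_par.1 this).1

/-- Whether an instance is dead depends only on which variables receive dead values, so enriching a
live value never revives a dead component. -/
theorem dead_subst_iff {V : Type} {σ τ : V → Proc} (h : ∀ x, Dead C (σ x) ↔ Dead C (τ x))
    (t : Term V) : Dead C (t.subst σ) ↔ Dead C (t.subst τ) := by
  induction t with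
  | zero => exact Iff.rfl
  | var x => exact h x
  | pre μ t _ => exact iff_of_false (not_dead_of_step (.pre _ _)) (not_dead_of_step (.pre _ _))
  | plus t u iht ihu => simp only [Term.subst, dead_plus, iht, ihu]
  | par t u iht ihu => simp only [Term.subst, dead_par, iht, ihu]
  | f t u iht _ => simp only [Term.subst, dead_f, iht]

/-! ### The processes `α^i`, `α^{≤ i}`, `p_n` and `f(α, p_n)` -/

namespace Term

theorem subst_sum {V W : Type} (σ : V → Term W) (l : List (Term V)) :
    (sum l).subst σ = sum (l.map (subst σ)) := by
  induction l with
  | nil => rfl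
  | cons t l ih =>
    cases l with
    | nil => rfl
    | cons u l => simpa [sum, subst] using ih

theorem subst_pow {V W : Type} (σ : V → Term W) (μ : Act) (i : ℕ) :
    (pow μ i : Term V).subst σ = pow μ i := by
  induction i with
  | zero => rfl
  | succ i ih => simp [pow, subst, ih]

theorem subst_powLE {V W : Type} (σ : V → Term W) (μ : Act) (i : ℕ) :
    (powLE μ i : Term V).subst σ = powLE μ i := by
  simp [powLE, subst_sum, Function.comp_def, subst_pow]

theorem subst_pn {V W : Type} (σ : V → Term W) (α : Name) (n : ℕ) :
    (pn α n : Term V).subst σ = pn α n := by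
  simp [pn, subst_sum, Function.comp_def, subst, subst_powLE]

theorem subst_epsLeft {V W : Type} (σ : V → Term W) (α : Name) (n : ℕ) :
    (epsLeft α n : Term V).subst σ = epsLeft α n := by
  simp [epsLeft, subst, subst_pn]

theorem subst_epsRight {V W : Type} (σ : V → Term W) (α : Name) (n : ℕ) :
    (epsRight α n : Term V).subst σ = epsRight α n := by
  simp [epsRight, subst, subst_pn, subst_sum, Function.comp_def, subst_powLE]

theorem subst_lift {V : Type} (σ : V → Proc) (p : Proc) : (lift p : Term V).subst σ = p := by
  unfold lift
  induction p with
  | zero => rfl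
  | var x => exact x.elim
  | pre μ t ih => simp [subst, ih]
  | plus t u iht ihu => simp [subst, iht, ihu]
  | par t u iht ihu => simp [subst, iht, ihu]
  | f t u iht ihu => simp [subst, iht, ihu]

end Term

open Term

theorem step_sum_iff {l : List Proc} {μ : Act} {r : Proc} :
    Step C (sum l) μ r ↔ ∃ t ∈ l, Step C t μ r := by
  induction l with
  | nil => exact iff_of_false (dead_zero _ _) (by simp)
  | cons t l ih =>
    cases l with
    | nil => simp [sum]
    | cons u l =>
      rw [List.exists_mem_cons_iff, ← ih]
      constructor
      · intro h
        cases h with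
        | plusLeft _ h => exact .inl h
        | plusRight _ h => exact .inr h
      · rintro (h | h)
        · exact .plusLeft _ h
        · exact .plusRight _ h

theorem step_pre_iff {μ ν : Act} {p r : Proc} : Step C (.pre μ p) ν r ↔ ν = μ ∧ r = p := by
  constructor
  · rintro ⟨⟩
    exact ⟨rfl, rfl⟩
  · rintro ⟨rfl, rfl⟩
    exact .pre _ _

theorem step_powLE_iff {μ ν : Act} {i : ℕ} {r : Proc} :
    Step C (powLE μ i) ν r ↔ ν = μ ∧ ∃ j < i, r = pow μ j := by
  simp only [powLE, step_sum_iff, List.mem_map, List.mem_range, pow]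
  constructor
  · rintro ⟨_, ⟨j, hj, rfl⟩, h⟩
    obtain ⟨rfl, rfl⟩ := step_pre_iff.1 h
    exact ⟨rfl, j, hj, rfl⟩
  · rintro ⟨rfl, j, hj, rfl⟩
    exact ⟨_, ⟨j, hj, rfl⟩, .pre _ _⟩

theorem step_sum_pre_powLE_iff {μ ν ξ : Act} {n : ℕ} {r : Proc} :
    Step C (sum ((List.range (n + 1)).map fun i => .pre μ (powLE ξ i))) ν r ↔
      ν = μ ∧ ∃ i ≤ n, r = powLE ξ i := by
  simp only [step_sum_iff, List.mem_map, List.mem_range, Nat.lt_succ_iff]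
  constructor
  · rintro ⟨_, ⟨j, hj, rfl⟩, h⟩
    obtain ⟨rfl, rfl⟩ := step_pre_iff.1 h
    exact ⟨rfl, j, hj, rfl⟩
  · rintro ⟨rfl, j, hj, rfl⟩
    exact ⟨_, ⟨j, hj, rfl⟩, .pre _ _⟩

theorem step_pn_iff {ν : Act} {n : ℕ} {r : Proc} :
    Step C (pn α n) ν r ↔ ν = .vis α.co ∧ ∃ i ≤ n, r = powLE (.vis α) i :=
  step_sum_pre_powLE_iff

/-- The process can perform `μ` at least `k` times in a row. -/
def CanRepeat (C : Set Name) (μ : Act) : ℕ → Proc → Prop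
  | 0, _ => True
  | k + 1, p => ∃ r, Step C p μ r ∧ CanRepeat C μ k r

theorem CanRepeat.of_bisim {μ : Act} {k : ℕ} {p q : Proc} (hp : CanRepeat C μ k p)
    (h : Bisim C p q) : CanRepeat C μ k q := by
  induction k generalizing p q with
  | zero => trivial
  | succ k ih =>
    obtain ⟨r, hr, hk⟩ := hp
    obtain ⟨s, hs, hrs⟩ := h.step hr
    exact ⟨s, hs, ih hk hrs⟩

theorem canRepeat_pow {μ : Act} {k i : ℕ} : CanRepeat C μ k (pow μ i) ↔ k ≤ i := by
  induction k generalizing i with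
  | zero => simp [CanRepeat]
  | succ k ih =>
    cases i with
    | zero => simp [CanRepeat, pow, dead_zero _ _]
    | succ i => simp [CanRepeat, pow, step_pre_iff, ih]

theorem canRepeat_powLE {μ : Act} {k i : ℕ} : CanRepeat C μ k (powLE μ i) ↔ k ≤ i := by
  cases k with
  | zero => simp [CanRepeat]
  | succ k =>
    simp only [CanRepeat, step_powLE_iff]
    constructor
    · rintro ⟨_, ⟨_, j, hj, rfl⟩, h⟩
      have := canRepeat_pow.1 h
      omega
    · intro h
      exact ⟨_, ⟨trivial, k, h, rfl⟩, canRepeat_pow.2 le_rfl⟩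

/-- The index is the maximal number of consecutive `μ`-steps, a bisimulation invariant. -/
theorem powLE_inj {μ : Act} {i j : ℕ} (h : Bisim C (powLE μ i) (powLE μ j)) : i = j :=
  le_antisymm (canRepeat_powLE.1 ((canRepeat_powLE.2 le_rfl).of_bisim h))
    (canRepeat_powLE.1 ((canRepeat_powLE.2 le_rfl).of_bisim h.symm))

theorem dead_or_dead_of_par_bisim_powLE {i : ℕ} {q r : Proc}
    (h : Bisim C (.par q r) (powLE (.vis α) i)) : Dead C q ∨ Dead C r := by
  cases i with
  | zero => exact .inl (dead_par.1 (dead_zero.of_bisim h)).1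
  | succ i =>
    exact dead_or_dead_of_par_bisim (step_powLE_iff.2 ⟨rfl, 0, i.succ_pos, rfl⟩) dead_zero h

theorem step_pn_zero (n : ℕ) : Step C (pn α n) (.vis α.co) .zero :=
  step_pn_iff.2 ⟨rfl, 0, n.zero_le, rfl⟩

theorem dead_or_dead_of_par_bisim_pn {n : ℕ} {q r : Proc}
    (h : Bisim C (.par q r) (pn α n)) : Dead C q ∨ Dead C r :=
  dead_or_dead_of_par_bisim (step_pn_zero n) dead_zero h

theorem Name.co_ne (β : Name) : β.co ≠ β := by cases β <;> simp [Name.co]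

theorem Name.eq_or_eq_co (α β : Name) : β = α ∨ β = α.co := by
  cases α <;> cases β <;> simp [Name.co]

theorem step_epsLeft_vis (n : ℕ) : Step C (epsLeft α n) (.vis α) (.par .zero (pn α n)) :=
  .fLeft _ (.pre _ _)

theorem step_epsLeft_tau (hα : α ∈ C) {n i : ℕ} (hi : i ≤ n) :
    Step C (epsLeft α n) .tau (.par .zero (powLE (.vis α) i)) :=
  .fComm hα (.pre _ _) (step_pn_iff.2 ⟨rfl, i, hi, rfl⟩)

theorem step_epsLeft_cases {n : ℕ} {μ : Act} {r : Proc} (h : Step C (epsLeft α n) μ r) :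
    (μ = .vis α ∧ r = .par .zero (pn α n)) ∨
      (μ = .tau ∧ ∃ i ≤ n, r = .par .zero (powLE (.vis α) i)) := by
  unfold epsLeft at h
  cases h with
  | fLeft _ h =>
    obtain ⟨rfl, rfl⟩ := step_pre_iff.1 h
    exact .inl ⟨rfl, rfl⟩
  | fComm _ h h' =>
    obtain ⟨_, rfl⟩ := step_pre_iff.1 h
    obtain ⟨_, i, hi, rfl⟩ := step_pn_iff.1 h'
    exact .inr ⟨rfl, i, hi, rfl⟩

theorem epsLeft_bisim_epsRight (hα : α ∈ C) (n : ℕ) :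
    Bisim C (epsLeft α n) (epsRight α n) := by
  refine .of_steps ?_ ?_
  · intro μ r h
    rcases step_epsLeft_cases h with ⟨rfl, rfl⟩ | ⟨rfl, i, hi, rfl⟩
    · exact ⟨_, .plusLeft _ (.pre _ _), bisim_par_right dead_zero⟩
    · exact ⟨_, .plusRight _ (step_sum_pre_powLE_iff.2 ⟨rfl, i, hi, rfl⟩),
        bisim_par_right dead_zero⟩
  · intro μ r h
    unfold epsRight at h
    cases h with
    | plusLeft _ h =>
      obtain ⟨rfl, rfl⟩ := step_pre_iff.1 h
      exact ⟨_, step_epsLeft_vis n, bisim_par_right dead_zero⟩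
    | plusRight _ h =>
      obtain ⟨rfl, i, hi, rfl⟩ := step_sum_pre_powLE_iff.1 h
      exact ⟨_, step_epsLeft_tau hα hi, bisim_par_right dead_zero⟩

/-- Every initial transition of the process is, up to bisimilarity, one of `f(α, p_n)`. -/
structure BelowEps (C : Set Name) (α : Name) (n : ℕ) (p : Proc) : Prop where
  not_co : ∀ r, ¬ Step C p (.vis α.co) r
  vis : ∀ r, Step C p (.vis α) r → Bisim C r (pn α n)
  tau : ∀ r, Step C p .tau r → ∃ i, Bisim C r (powLE (.vis α) i)

namespace BelowEps

variable {n : ℕ}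

theorem of_bisim {p : Proc} (h : Bisim C p (epsLeft α n)) : BelowEps C α n p := by
  refine ⟨fun r hs => ?_, fun r hs => ?_, fun r hs => ?_⟩ <;>
    obtain ⟨s, h1, h2⟩ := h.step hs <;>
    rcases step_epsLeft_cases h1 with ⟨h3, rfl⟩ | ⟨h3, i, hi, rfl⟩
  · exact α.co_ne (Act.vis.inj h3)
  · cases h3
  · exact h2.trans (bisim_par_right dead_zero)
  · cases h3
  · cases h3
  · exact ⟨i, h2.trans (bisim_par_right dead_zero)⟩

/-- `BelowEps` only bounds initial transitions from above. Unlike bisimilarity with `f(α, p_n)` it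
therefore passes to summands, as inductions on process structure require. -/
theorem of_le {p q : Proc} (hq : BelowEps C α n q)
    (h : ∀ μ r, Step C p μ r → ∃ s, Step C q μ s ∧ Bisim C r s) : BelowEps C α n p := by
  refine ⟨fun r hs => ?_, fun r hs => ?_, fun r hs => ?_⟩ <;> obtain ⟨s, h1, h2⟩ := h _ _ hs
  · exact hq.not_co _ h1
  · exact h2.trans (hq.vis _ h1)
  · obtain ⟨i, hi⟩ := hq.tau _ h1
    exact ⟨i, h2.trans hi⟩

theorem plus_left {p q : Proc} (h : BelowEps C α n (.plus p q)) : BelowEps C α n p :=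
  h.of_le fun _ r hs => ⟨r, .plusLeft _ hs, .refl r⟩

theorem plus_right {p q : Proc} (h : BelowEps C α n (.plus p q)) : BelowEps C α n q :=
  h.of_le fun _ r hs => ⟨r, .plusRight _ hs, .refl r⟩

theorem congr {p q : Proc} (h : BelowEps C α n q) (hpq : Bisim C p q) : BelowEps C α n p :=
  h.of_le fun _ _ hs => hpq.step hs

/-- The arguments of an application of `f` below `f(α, p_n)`, the second of which is able to
perform `ᾱ`. -/
theorem args {p q p' q' : Proc} (h : BelowEps C α n (.f p q)) (hp : Step C p (.vis α) p')
    (hq : Step C q (.vis α.co) q') :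
    Bisim C p (.pre (.vis α) .zero) ∧ Bisim C q (pn α n) := by
  -- An `α`-residual of `p` in parallel with the live `q` is bisimilar to `p_n`, which does not
  -- decompose.
  have hdead : ∀ r, Step C p (.vis α) r → Dead C r := fun r hr =>
    (dead_or_dead_of_par_bisim_pn (h.vis _ (.fLeft q hr))).resolve_right (not_dead_of_step hq)
  refine ⟨.of_steps (fun μ r hr => ?_) fun μ r hr => ?_,
    (bisim_par_right (hdead _ hp)).symm.trans (h.vis _ (.fLeft q hp))⟩
  · rcases μ with β | _
    · rcases α.eq_or_eq_co β with rfl | rfl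
      · exact ⟨_, .pre _ _, (hdead _ hr).bisim_zero⟩
      · exact (h.not_co _ (.fLeft _ hr)).elim
    -- After a `τ` of `p`, the untouched `q` could still perform `ᾱ`, which no `α^{≤ i}` can.
    · obtain ⟨i, hi⟩ := h.tau _ (.fLeft q hr)
      obtain ⟨s, hs, _⟩ := hi.step (.parRight r hq)
      exact (α.co_ne (Act.vis.inj (step_powLE_iff.1 hs).1)).elim
  · obtain ⟨rfl, rfl⟩ := step_pre_iff.1 hr
    exact ⟨_, hp, (hdead _ hp).bisim_zero⟩

end BelowEps

/-! ### Extending a subterm by a summand -/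

/-- The second process arises from the first one by adding the summand `q` to some occurrences of
the subterm `Y`. -/
inductive Enlarges (Y q : Proc) : Proc → Proc → Prop where
  | refl (p : Proc) : Enlarges Y q p p
  | base : Enlarges Y q Y (.plus Y q)
  | pre {p p' : Proc} (μ : Act) : Enlarges Y q p p' → Enlarges Y q (.pre μ p) (.pre μ p')
  | plus {p p' r r' : Proc} : Enlarges Y q p p' → Enlarges Y q r r' → Enlarges Y q (.plus p r) (.plus p' r')
  | par {p p' r r' : Proc} : Enlarges Y q p p' → Enlarges Y q r r' → Enlarges Y q (.par p r) (.par p' r')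
  | f {p p' r r' : Proc} : Enlarges Y q p p' → Enlarges Y q r r' → Enlarges Y q (.f p r) (.f p' r')

/-- The substitution `σ` with the summand `q` added to the value at `y`. -/
def addSummand (σ : ℕ → Proc) (y : ℕ) (q : Proc) : ℕ → Proc :=
  Function.update σ y (.plus (σ y) q)

theorem addSummand_self (σ : ℕ → Proc) (y : ℕ) (q : Proc) :
    addSummand σ y q y = .plus (σ y) q := by simp [addSummand]

/-- Comparing the two instances as closed processes gives a relation that survives transitions; once
a value of `σ` has moved, the residual need no longer be an instance under `σ`. -/
theorem enlarges_addSummand (σ : ℕ → Proc) (y : ℕ) (q : Proc) (t : Term ℕ) :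
    Enlarges (σ y) q (t.subst σ) (t.subst (addSummand σ y q)) := by
  induction t with
  | zero => exact .refl _
  | var x =>
    by_cases hx : x = y
    · subst hx
      simpa [subst, addSummand] using Enlarges.base
    · simpa [subst, addSummand, hx] using Enlarges.refl _
  | pre μ t ih => exact .pre μ ih
  | plus t u iht ihu => exact .plus iht ihu
  | par t u iht ihu => exact .par iht ihu
  | f t u iht ihu => exact .f iht ihu

theorem dead_addSummand_iff {σ : ℕ → Proc} {y : ℕ} (q : Proc) (hy : ¬ Dead C (σ y))
    (t : Term ℕ) : Dead C (t.subst (addSummand σ y q)) ↔ Dead C (t.subst σ) := by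
  refine dead_subst_iff (fun x => ?_) t
  by_cases hx : x = y
  · subst hx
    rw [addSummand_self, dead_plus]
    exact iff_of_false (fun h => hy h.1) hy
  · simp [addSummand, hx]

namespace Enlarges

variable {Y q : Proc}

theorem step {p p' r : Proc} {μ : Act} (h : Enlarges Y q p p') (hs : Step C p μ r) :
    ∃ r', Step C p' μ r' ∧ Enlarges Y q r r' := by
  induction h generalizing μ r with
  | refl p => exact ⟨r, hs, .refl r⟩
  | base => exact ⟨r, .plusLeft _ hs, .refl r⟩
  | pre _ h _ =>
    obtain ⟨rfl, rfl⟩ := step_pre_iff.1 hs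
    exact ⟨_, .pre _ _, h⟩
  | plus _ _ ih1 ih2 =>
    cases hs with
    | plusLeft _ hs =>
      obtain ⟨r', h1, h2⟩ := ih1 hs
      exact ⟨r', .plusLeft _ h1, h2⟩
    | plusRight _ hs =>
      obtain ⟨r', h1, h2⟩ := ih2 hs
      exact ⟨r', .plusRight _ h1, h2⟩
  | par h h' ih1 ih2 =>
    cases hs with
    | parLeft _ hs =>
      obtain ⟨r', h1, h2⟩ := ih1 hs
      exact ⟨_, .parLeft _ h1, .par h2 h'⟩
    | parRight _ hs =>
      obtain ⟨r', h1, h2⟩ := ih2 hs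
      exact ⟨_, .parRight _ h1, .par h h2⟩
    | parComm hs hs' =>
      obtain ⟨r', h1, h2⟩ := ih1 hs
      obtain ⟨s', h1', h2'⟩ := ih2 hs'
      exact ⟨_, .parComm h1 h1', .par h2 h2'⟩
  | f _ h' ih1 ih2 =>
    cases hs with
    | fLeft _ hs =>
      obtain ⟨r', h1, h2⟩ := ih1 hs
      exact ⟨_, .fLeft _ h1, .par h2 h'⟩
    | fComm hβ hs hs' =>
      obtain ⟨r', h1, h2⟩ := ih1 hs
      obtain ⟨s', h1', h2'⟩ := ih2 hs'
      exact ⟨_, .fComm hβ h1 h1', .par h2 h2'⟩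

theorem dead {p p' : Proc} (h : Enlarges Y q p p') (hd : Dead C p') : Dead C p := by
  intro μ r hs
  obtain ⟨_, h1, _⟩ := h.step hs
  exact hd _ _ h1

/-- If `Y` can perform `β`, then adding the summand `β.q` to `Y` only adds transitions labelled
`β` or `τ`, to processes that could already perform this action. -/
theorem step_back {Y' p p' r' : Proc} {μ : Act} {β : Name}
    (hY : Step C Y (.vis β) Y') (h : Enlarges Y (.pre (.vis β) q) p p') (hs : Step C p' μ r') :
    (∃ r, Step C p μ r ∧ Enlarges Y (.pre (.vis β) q) r r') ∨
      ((μ = .vis β ∨ μ = .tau) ∧ ∃ r, Step C p μ r) := by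
  induction h generalizing μ r' with
  | refl p => exact .inl ⟨r', hs, .refl r'⟩
  | base =>
    cases hs with
    | plusLeft _ hs => exact .inl ⟨r', hs, .refl r'⟩
    | plusRight _ hs =>
      obtain ⟨rfl, rfl⟩ := step_pre_iff.1 hs
      exact .inr ⟨.inl rfl, _, hY⟩
  | pre _ h _ =>
    obtain ⟨rfl, rfl⟩ := step_pre_iff.1 hs
    exact .inl ⟨_, .pre _ _, h⟩
  | plus _ _ ih1 ih2 =>
    cases hs with
    | plusLeft _ hs =>
      rcases ih1 hs with ⟨r, h1, h2⟩ | ⟨h1, r, h2⟩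
      · exact .inl ⟨r, .plusLeft _ h1, h2⟩
      · exact .inr ⟨h1, r, .plusLeft _ h2⟩
    | plusRight _ hs =>
      rcases ih2 hs with ⟨r, h1, h2⟩ | ⟨h1, r, h2⟩
      · exact .inl ⟨r, .plusRight _ h1, h2⟩
      · exact .inr ⟨h1, r, .plusRight _ h2⟩
  | par h h' ih1 ih2 =>
    cases hs with
    | parLeft _ hs =>
      rcases ih1 hs with ⟨r, h1, h2⟩ | ⟨h1, r, h2⟩
      · exact .inl ⟨_, .parLeft _ h1, .par h2 h'⟩
      · exact .inr ⟨h1, _, .parLeft _ h2⟩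
    | parRight _ hs =>
      rcases ih2 hs with ⟨r, h1, h2⟩ | ⟨h1, r, h2⟩
      · exact .inl ⟨_, .parRight _ h1, .par h h2⟩
      · exact .inr ⟨h1, _, .parRight _ h2⟩
    | parComm hs hs' =>
      rcases ih1 hs with ⟨r, h1, h2⟩ | ⟨_, r, h1⟩ <;>
        rcases ih2 hs' with ⟨s, h1', h2'⟩ | ⟨_, s, h1'⟩
      · exact .inl ⟨_, .parComm h1 h1', .par h2 h2'⟩
      all_goals exact .inr ⟨.inr rfl, _, .parComm h1 h1'⟩
  | f _ h' ih1 ih2 =>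
    cases hs with
    | fLeft _ hs =>
      rcases ih1 hs with ⟨r, h1, h2⟩ | ⟨h1, r, h2⟩
      · exact .inl ⟨_, .fLeft _ h1, .par h2 h'⟩
      · exact .inr ⟨h1, _, .fLeft _ h2⟩
    | fComm hβ hs hs' =>
      rcases ih1 hs with ⟨r, h1, h2⟩ | ⟨_, r, h1⟩ <;>
        rcases ih2 hs' with ⟨s, h1', h2'⟩ | ⟨_, s, h1'⟩
      · exact .inl ⟨_, .fComm hβ h1 h1', .par h2 h2'⟩
      all_goals exact .inr ⟨.inr rfl, _, .fComm hβ h1 h1'⟩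

theorem can_step_back {Y' p p' r' : Proc} {μ : Act} {β : Name} (hY : Step C Y (.vis β) Y')
    (h : Enlarges Y (.pre (.vis β) q) p p') (hs : Step C p' μ r') : ∃ r, Step C p μ r := by
  rcases h.step_back hY hs with ⟨r, h1, _⟩ | ⟨_, h1⟩
  exacts [⟨r, h1⟩, h1]

/-- A process that performs no other actions than `α` is not affected by additions to a
subterm that can perform `ᾱ`. -/
theorem bisim_powLE {Y' p p' : Proc} {i : ℕ} (hY : Step C Y (.vis α.co) Y')
    (h : Enlarges Y (.pre (.vis α.co) q) p p') (hp : Bisim C p (powLE (.vis α) i)) :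
    Bisim C p' (powLE (.vis α) i) := by
  refine .trans (.symm ?_) hp
  -- Up to bisimilarity the processes `α^{≤ i}` and `α^i` are closed under transitions and perform
  -- only `α`, whereas the extra transitions from `step_back` need `ᾱ` or `τ`.
  have hstep : ∀ p μ r, (∃ i, Bisim C p (powLE (.vis α) i) ∨ Bisim C p (pow (.vis α) i)) →
      Step C p μ r → μ = .vis α ∧ ∃ i, Bisim C r (powLE (.vis α) i) ∨ Bisim C r (pow (.vis α) i) := by
    rintro p μ r ⟨i, hp | hp⟩ hs
    · obtain ⟨s, h1, h2⟩ := hp.step hs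
      obtain ⟨rfl, j, _, rfl⟩ := step_powLE_iff.1 h1
      exact ⟨rfl, j, .inr h2⟩
    · obtain ⟨s, h1, h2⟩ := hp.step hs
      cases i with
      | zero => exact (dead_zero _ _ h1).elim
      | succ i =>
        obtain ⟨rfl, rfl⟩ := step_pre_iff.1 h1
        exact ⟨rfl, i, .inr h2⟩
  refine .of_rel (fun p p' => Enlarges Y (.pre (.vis α.co) q) p p' ∧
    ∃ i, Bisim C p (powLE (.vis α) i) ∨ Bisim C p (pow (.vis α) i)) ?_ ?_ ⟨h, i, .inl hp⟩
  · rintro p p' μ r ⟨h, hp⟩ hs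
    obtain ⟨r', h1, h2⟩ := h.step hs
    exact ⟨r', h1, h2, (hstep _ _ _ hp hs).2⟩
  · rintro p p' μ r' ⟨h, hp⟩ hs
    rcases h.step_back hY hs with ⟨r, h1, h2⟩ | ⟨hμ, r, h1⟩
    · exact ⟨r, h1, h2, (hstep _ _ _ hp h1).2⟩
    · obtain ⟨rfl, _⟩ := hstep _ _ _ hp h1
      rcases hμ with hμ | hμ
      · exact (α.co_ne (Act.vis.inj hμ).symm).elim
      · cases hμ

end Enlarges

/-! ### The invariant -/

/-- Up to components that are bisimilar to `0`, the process has a summand `f(r, s)` with `r`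
bisimilar to `α` and `s` bisimilar to `p_n`. -/
def Exposes (C : Set Name) (α : Name) (n : ℕ) : Proc → Prop
  | .zero => False
  | .var _ => False
  | .pre _ _ => False
  | .plus p q => Exposes C α n p ∨ Exposes C α n q
  | .par p q => (Dead C p ∧ Exposes C α n q) ∨ (Dead C q ∧ Exposes C α n p)
  | .f p q => (Dead C q ∧ Exposes C α n p) ∨
      (Bisim C p (.pre (.vis α) .zero) ∧ Bisim C q (pn α n))

variable {n : ℕ}

/-- Dead components can be dropped up to bisimilarity, and at the leaf congruence of `f` applies.
This is the lower bound on behaviour that complements `BelowEps`. -/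
theorem Exposes.step {p e : Proc} {μ : Act} (h : Exposes C α n p)
    (hs : Step C (epsLeft α n) μ e) : ∃ r, Step C p μ r ∧ Bisim C r e := by
  have transport : ∀ {p q : Proc}, Bisim C p q → (∃ r, Step C p μ r ∧ Bisim C r e) →
      ∃ r, Step C q μ r ∧ Bisim C r e := by
    rintro p q h ⟨r, h1, h2⟩
    obtain ⟨s, h3, h4⟩ := h.step h1
    exact ⟨s, h3, h4.symm.trans h2⟩
  induction p with
  | zero => exact h.elim
  | var x => exact h.elim
  | pre μ p _ => exact h.elim
  | plus p q ihp ihq =>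
    rcases h with h | h
    · obtain ⟨r, h1, h2⟩ := ihp h
      exact ⟨r, .plusLeft _ h1, h2⟩
    · obtain ⟨r, h1, h2⟩ := ihq h
      exact ⟨r, .plusRight _ h1, h2⟩
  | par p q ihp ihq =>
    rcases h with ⟨hd, h⟩ | ⟨hd, h⟩
    · exact transport (bisim_par_right hd).symm (ihq h)
    · exact transport (bisim_par_left hd).symm (ihp h)
  | f p q ihp _ =>
    rcases h with ⟨hd, h⟩ | ⟨h1, h2⟩
    · exact transport (bisim_f_left hd).symm (ihp h)
    · exact transport (h1.f h2).symm ⟨e, hs, .refl e⟩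

theorem Exposes.not_dead {p : Proc} (h : Exposes C α n p) : ¬ Dead C p := by
  obtain ⟨_, h1, _⟩ := h.step (step_epsLeft_vis n)
  exact not_dead_of_step h1

/-- A process with the required component whose transitions are among those of a process
bisimilar to `f(α, p_n)` is itself bisimilar to `f(α, p_n)`. -/
theorem Exposes.bisim {p q : Proc} (h : Exposes C α n p) (hq : Bisim C q (epsLeft α n))
    (hle : ∀ μ r, Step C p μ r → Step C q μ r) : Bisim C p (epsLeft α n) :=
  .of_steps (fun _ _ hs => hq.step (hle _ _ hs)) fun _ _ hs => h.step hs

theorem step_of_mem_summands {p r s : Proc} {μ : Act} (hr : r ∈ p.summands) (hs : Step C r μ s) :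
    Step C p μ s := by
  induction p with
  | plus p q ihp ihq =>
    rcases hr with hr | hr
    · exact .plusLeft _ (ihp hr)
    · exact .plusRight _ (ihq hr)
  | _ => cases hr; exact hs

theorem Exposes.exists_summand {p : Proc} (h : Exposes C α n p) :
    ∃ r ∈ p.summands, Exposes C α n r := by
  induction p with
  | plus p q ihp ihq =>
    rcases h with h | h
    · obtain ⟨r, h1, h2⟩ := ihp h
      exact ⟨r, .inl h1, h2⟩
    · obtain ⟨r, h1, h2⟩ := ihq h
      exact ⟨r, .inr h1, h2⟩
  | _ => exact ⟨_, rfl, h⟩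

/-- A prefix cannot offer both `α` and `τ`. A parallel composition of live components is excluded
because its `α`-residual is bisimilar to the indecomposable `p_n`: the component that stood still
would be `p_n`, and its `ᾱ` would be available from the start. Only an application of `f` remains,
and `BelowEps.args` identifies its arguments. -/
theorem exposes_of_mem_summands {p r : Proc} (hα : α ∈ C) (hr : r ∈ p.summands)
    (h : Bisim C r (epsLeft α n)) (h0 : ¬ HasZeroFactor C r) : Exposes C α n p := by
  induction p with
  | zero =>
    cases hr
    exact (dead_zero.of_bisim h.symm _ _ (step_epsLeft_vis n)).elim
  | var x => exact x.elim
  | pre μ p _ =>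
    cases hr
    obtain ⟨_, h1, _⟩ := h.symm.step (step_epsLeft_vis n)
    obtain ⟨_, h2, _⟩ := h.symm.step (step_epsLeft_tau hα n.zero_le)
    cases (step_pre_iff.1 h1).1.trans (step_pre_iff.1 h2).1.symm
  | plus p q ihp ihq =>
    rcases hr with hr | hr
    · exact .inl (ihp hr)
    · exact .inr (ihq hr)
  | par p q _ _ =>
    cases hr
    simp only [HasZeroFactor, bisim_zero_iff, not_or] at h0
    have hb := BelowEps.of_bisim h
    obtain ⟨_, h1, _⟩ := h.symm.step (step_epsLeft_vis n)
    have h2 := hb.vis _ h1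
    exfalso
    cases h1 with
    | parLeft _ _ =>
      have hd := (dead_or_dead_of_par_bisim_pn h2).resolve_right h0.2
      obtain ⟨_, h3, _⟩ := ((bisim_par_right hd).symm.trans h2).symm.step (step_pn_zero n)
      exact hb.not_co _ (.parRight _ h3)
    | parRight _ _ =>
      have hd := (dead_or_dead_of_par_bisim_pn h2).resolve_left h0.1
      obtain ⟨_, h3, _⟩ := ((bisim_par_left hd).symm.trans h2).symm.step (step_pn_zero n)
      exact hb.not_co _ (.parLeft _ h3)
  | f p q _ _ =>
    cases hr
    simp only [HasZeroFactor, bisim_zero_iff, not_or] at h0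
    have hb := BelowEps.of_bisim h
    obtain ⟨_, h1, _⟩ := h.symm.step (step_epsLeft_vis n)
    have h2 := hb.vis _ h1
    cases h1 with
    | fLeft _ h1 =>
      have hd := (dead_or_dead_of_par_bisim_pn h2).resolve_right h0.2
      obtain ⟨_, h3, _⟩ := ((bisim_par_right hd).symm.trans h2).symm.step (step_pn_zero n)
      exact .inr (hb.args h1 h3)

/-! ### Sound equations between small terms preserve the invariant -/

/-- The new `ᾱ`-step can only come from the added summand. Its residual is dead, so everything
standing beside that occurrence of `Y` is dead, and the invariant of `Y` carries over to the whole.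
-/
theorem Enlarges.exposes_of_step_dead {Y p p' w : Proc} (hY : Exposes C α n Y)
    (h : Enlarges Y (.pre (.vis α.co) .zero) p p') (hp : ∀ r, ¬ Step C p (.vis α.co) r)
    (hs : Step C p' (.vis α.co) w) (hw : Dead C w) : Exposes C α n p := by
  induction h generalizing w with
  | refl p => exact (hp _ hs).elim
  | base => exact hY
  | pre μ h _ =>
    obtain ⟨rfl, rfl⟩ := step_pre_iff.1 hs
    exact (hp _ (.pre _ _)).elim
  | plus _ _ ih1 ih2 =>
    cases hs with
    | plusLeft _ hs => exact .inl (ih1 (fun _ h => hp _ (.plusLeft _ h)) hs hw)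
    | plusRight _ hs => exact .inr (ih2 (fun _ h => hp _ (.plusRight _ h)) hs hw)
  | par h h' ih1 ih2 =>
    cases hs with
    | parLeft _ hs =>
      rw [dead_par] at hw
      exact .inr ⟨h'.dead hw.2, ih1 (fun _ h => hp _ (.parLeft _ h)) hs hw.1⟩
    | parRight _ hs =>
      rw [dead_par] at hw
      exact .inl ⟨h.dead hw.1, ih2 (fun _ h => hp _ (.parRight _ h)) hs hw.2⟩
  | f h h' ih1 _ =>
    cases hs with
    | fLeft _ hs =>
      rw [dead_par] at hw
      exact .inl ⟨h'.dead hw.2, ih1 (fun _ h => hp _ (.fLeft _ h)) hs hw.1⟩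

theorem step_bisim_pre_zero {p : Proc} {μ : Act} (h : Bisim C p (.pre μ .zero)) :
    ∃ r, Step C p μ r ∧ Dead C r := by
  obtain ⟨r, h1, h2⟩ := h.symm.step (.pre _ _)
  exact ⟨r, h1, dead_zero.of_bisim h2.symm⟩

/-- Old `τ`-derivatives resemble `α^{≤ i}` and remain so after the enlargement, hence a `τ`-step to
`ᾱ` must use the new summand. As `p` has no `ᾱ`-step, this can only be a communication inside an `f`
whose left argument does `α` and whose right argument does `ᾱ`. The residual `ᾱ` is needed: a
residual `0` would be hidden by `α^{≤ 0}`. -/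
theorem Enlarges.exposes_of_step_tau {Y Y' p p' w : Proc} (hY : Step C Y (.vis α.co) Y')
    (h : Enlarges Y (.pre (.vis α.co) (.pre (.vis α.co) .zero)) p p') (hp : BelowEps C α n p)
    (hs : Step C p' .tau w) (hw : Bisim C w (.pre (.vis α.co) .zero)) : Exposes C α n p := by
  have not_powLE : ∀ {w i}, Bisim C w (.pre (.vis α.co) .zero) →
      ¬ Bisim C w (powLE (.vis α) i) := by
    intro w i h1 h2
    obtain ⟨r, h3, _⟩ := step_bisim_pre_zero h1
    obtain ⟨s, h4, _⟩ := h2.step h3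
    exact α.co_ne (Act.vis.inj (step_powLE_iff.1 h4).1)
  have par_cases : ∀ {r s : Proc}, Bisim C (.par r s) (.pre (.vis α.co) .zero) →
      (Dead C s ∧ Bisim C r (.pre (.vis α.co) .zero)) ∨
        (Dead C r ∧ Bisim C s (.pre (.vis α.co) .zero)) := by
    intro r s h
    rcases dead_or_dead_of_par_bisim (.pre _ _) dead_zero h with hd | hd
    · exact .inr ⟨hd, (bisim_par_right hd).symm.trans h⟩
    · exact .inl ⟨hd, (bisim_par_left hd).symm.trans h⟩
  induction h generalizing w with
  | refl p =>
    obtain ⟨i, hi⟩ := hp.tau _ hs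
    exact (not_powLE hw hi).elim
  | base => exact (hp.not_co _ hY).elim
  | pre μ h _ =>
    obtain ⟨rfl, rfl⟩ := step_pre_iff.1 hs
    obtain ⟨i, hi⟩ := hp.tau _ (.pre _ _)
    exact (not_powLE hw (h.bisim_powLE hY hi)).elim
  | plus _ _ ih1 ih2 =>
    cases hs with
    | plusLeft _ hs => exact .inl (ih1 hp.plus_left hs hw)
    | plusRight _ hs => exact .inr (ih2 hp.plus_right hs hw)
  | par h h' ih1 ih2 =>
    cases hs with
    | parLeft _ hs =>
      rcases par_cases hw with ⟨hd, hw⟩ | ⟨_, hw⟩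
      · have hd := h'.dead hd
        exact .inr ⟨hd, ih1 (hp.congr (bisim_par_left hd).symm) hs hw⟩
      · obtain ⟨r, h1, _⟩ := step_bisim_pre_zero hw
        obtain ⟨s, h2⟩ := h'.can_step_back hY h1
        exact (hp.not_co _ (.parRight _ h2)).elim
    | parRight _ hs =>
      rcases par_cases hw with ⟨_, hw⟩ | ⟨hd, hw⟩
      · obtain ⟨r, h1, _⟩ := step_bisim_pre_zero hw
        obtain ⟨s, h2⟩ := h.can_step_back hY h1
        exact (hp.not_co _ (.parLeft _ h2)).elim
      · have hd := h.dead hd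
        exact .inl ⟨hd, ih2 (hp.congr (bisim_par_right hd).symm) hs hw⟩
    | @parComm _ _ _ _ β hs hs' =>
      obtain ⟨r, h1⟩ := h.can_step_back hY hs
      obtain ⟨s, h2⟩ := h'.can_step_back hY hs'
      rcases α.eq_or_eq_co β with rfl | rfl
      · exact (hp.not_co _ (.parRight _ h2)).elim
      · exact (hp.not_co _ (.parLeft _ h1)).elim
  | f h h' ih1 _ =>
    cases hs with
    | fLeft _ hs =>
      rcases par_cases hw with ⟨hd, hw⟩ | ⟨_, hw⟩
      · have hd := h'.dead hd
        exact .inl ⟨hd, ih1 (hp.congr (bisim_f_left hd).symm) hs hw⟩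
      -- An `ᾱ` of the right argument is not a step of the `f`-term itself, but it becomes available
      -- after the `τ` of the left argument, contradicting the shape `α^{≤ i}`.
      · obtain ⟨r, h1, _⟩ := step_bisim_pre_zero hw
        obtain ⟨s, h2⟩ := h'.can_step_back hY h1
        obtain ⟨r', h3⟩ := h.can_step_back hY hs
        obtain ⟨i, hi⟩ := hp.tau _ (.fLeft _ h3)
        obtain ⟨_, h4, _⟩ := hi.step (.parRight r' h2)
        exact (α.co_ne (Act.vis.inj (step_powLE_iff.1 h4).1)).elim
    | @fComm _ _ _ _ β _ hs hs' =>
      obtain ⟨r, h1⟩ := h.can_step_back hY hs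
      obtain ⟨s, h2⟩ := h'.can_step_back hY hs'
      rcases α.eq_or_eq_co β with rfl | rfl
      · exact .inr (hp.args h1 h2)
      · exact (hp.not_co _ (.fLeft _ h1)).elim

/-- Indecomposability forces the live `q` itself to be bisimilar to `α^{≤ i}`, which determines `i`.
-/
theorem card_le_one_of_alive {α : Name} {q : Proc} (hq : ¬ Dead C q) (I : Finset ℕ)
    (hI : ∀ i ∈ I, ∃ r, Bisim C (.par r q) (powLE (.vis α) i)) : I.card ≤ 1 := by
  have key : ∀ i ∈ I, Bisim C q (powLE (.vis α) i) := by
    intro i hi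
    obtain ⟨r, hr⟩ := hI i hi
    exact (bisim_par_right ((dead_or_dead_of_par_bisim_powLE hr).resolve_right hq)).symm.trans hr
  exact Finset.card_le_one.2 fun i hi j hj => powLE_inj ((key i hi).symm.trans (key j hj))

/-- If an instance of a small term has many `ᾱ`-derivatives of the form `α^{≤ i}`, then one of the
variables of the term contributes to its `ᾱ`-transitions. -/
theorem exists_contributing_var (σ : ℕ → Proc) (t : Term ℕ) (I : Finset ℕ)
    (hI : ∀ i ∈ I, ∃ r, Step C (t.subst σ) (.vis α.co) r ∧ Bisim C r (powLE (.vis α) i))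
    (hcard : t.size + 1 < I.card) (q : Proc) :
    ∃ y, (∃ r, Step C (σ y) (.vis α.co) r) ∧
      ∃ w, Step C (t.subst (addSummand σ y (.pre (.vis α.co) q))) (.vis α.co) w ∧
        Bisim C w q := by
  classical
  have split : ∀ {P Q : ℕ → Prop} {k l : ℕ} {I : Finset ℕ}, (∀ i ∈ I, P i ∨ Q i) →
      k + l < I.card → k < (I.filter P).card ∨ l < (I.filter Q).card := by
    intro P Q k l I h hc
    have h1 : I ⊆ I.filter P ∪ I.filter Q := by
      intro i hi
      rcases h i hi with h | h <;> simp [hi, h]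
    have h2 := (Finset.card_le_card h1).trans (Finset.card_union_le _ _)
    omega
  induction t generalizing I with
  | zero =>
    obtain ⟨i, hi⟩ := Finset.card_pos.1 (Nat.zero_lt_of_lt hcard)
    obtain ⟨r, hr, _⟩ := hI i hi
    exact (dead_zero _ _ hr).elim
  | var y =>
    obtain ⟨i, hi⟩ := Finset.card_pos.1 (Nat.zero_lt_of_lt hcard)
    obtain ⟨r, hr, _⟩ := hI i hi
    refine ⟨y, ⟨r, hr⟩, q, ?_, .refl q⟩
    rw [subst, addSummand_self]
    exact .plusRight _ (.pre _ _)
  | pre μ t _ =>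
    have hle : I.card ≤ 1 := Finset.card_le_one.2 fun i hi j hj => by
      obtain ⟨r, hr, h1⟩ := hI i hi
      obtain ⟨s, hs, h2⟩ := hI j hj
      obtain ⟨_, rfl⟩ := step_pre_iff.1 hr
      obtain ⟨_, rfl⟩ := step_pre_iff.1 hs
      exact powLE_inj (h1.symm.trans h2)
    omega
  | plus t u iht ihu =>
    have hor : ∀ i ∈ I,
        (∃ r, Step C (t.subst σ) (.vis α.co) r ∧ Bisim C r (powLE (.vis α) i)) ∨
        (∃ r, Step C (u.subst σ) (.vis α.co) r ∧ Bisim C r (powLE (.vis α) i)) := by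
      intro i hi
      obtain ⟨r, hr, h⟩ := hI i hi
      cases hr with
      | plusLeft _ hr => exact .inl ⟨r, hr, h⟩
      | plusRight _ hr => exact .inr ⟨r, hr, h⟩
    simp only [size] at hcard
    rcases split (k := t.size + 1) (l := u.size + 1) hor (by omega) with hc | hc
    · obtain ⟨y, hy, w, hw, h⟩ := iht _ (fun i hi => (Finset.mem_filter.1 hi).2) hc
      exact ⟨y, hy, w, .plusLeft _ hw, h⟩
    · obtain ⟨y, hy, w, hw, h⟩ := ihu _ (fun i hi => (Finset.mem_filter.1 hi).2) hc
      exact ⟨y, hy, w, .plusRight _ hw, h⟩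
  | par t u iht ihu =>
    simp only [size] at hcard
    by_cases hu : Dead C (u.subst σ)
    · obtain ⟨y, ⟨r, hr⟩, w, hw, h⟩ := iht I (fun i hi => by
        obtain ⟨r, hr, h⟩ := hI i hi
        obtain ⟨s, hs, h'⟩ := (bisim_par_left hu).step hr
        exact ⟨s, hs, h'.symm.trans h⟩) (by omega)
      have hu' := (dead_addSummand_iff (.pre (.vis α.co) q) (not_dead_of_step hr) u).2 hu
      exact ⟨y, ⟨r, hr⟩, _, .parLeft _ hw, (bisim_par_left hu').trans h⟩
    by_cases ht : Dead C (t.subst σ)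
    · obtain ⟨y, ⟨r, hr⟩, w, hw, h⟩ := ihu I (fun i hi => by
        obtain ⟨r, hr, h⟩ := hI i hi
        obtain ⟨s, hs, h'⟩ := (bisim_par_right ht).step hr
        exact ⟨s, hs, h'.symm.trans h⟩) (by omega)
      have ht' := (dead_addSummand_iff (.pre (.vis α.co) q) (not_dead_of_step hr) t).2 ht
      exact ⟨y, ⟨r, hr⟩, _, .parRight _ hw, (bisim_par_right ht').trans h⟩
    have hor : ∀ i ∈ I, (∃ r, Bisim C (.par r (u.subst σ)) (powLE (.vis α) i)) ∨
        (∃ r, Bisim C (.par r (t.subst σ)) (powLE (.vis α) i)) := by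
      intro i hi
      obtain ⟨r, hr, h⟩ := hI i hi
      cases hr with
      | parLeft _ _ => exact .inl ⟨_, h⟩
      | @parRight _ r _ _ _ =>
        -- The moved component has become dead, so `0` may replace it, with the stationary one on
        -- the right.
        refine .inr ⟨.zero, ?_⟩
        have hr := (dead_or_dead_of_par_bisim_powLE h).resolve_left ht
        exact ((bisim_par_right dead_zero).trans (bisim_par_left hr).symm).trans h
    exfalso
    rcases split (k := 1) (l := 1) hor (by omega) with hc | hc
    · exact hc.not_ge (card_le_one_of_alive hu _ fun i hi => (Finset.mem_filter.1 hi).2)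
    · exact hc.not_ge (card_le_one_of_alive ht _ fun i hi => (Finset.mem_filter.1 hi).2)
  | f t u iht _ =>
    simp only [size] at hcard
    by_cases hu : Dead C (u.subst σ)
    · obtain ⟨y, ⟨r, hr⟩, w, hw, h⟩ := iht I (fun i hi => by
        obtain ⟨r, hr, h⟩ := hI i hi
        obtain ⟨s, hs, h'⟩ := (bisim_f_left hu).step hr
        exact ⟨s, hs, h'.symm.trans h⟩) (by omega)
      have hu' := (dead_addSummand_iff (.pre (.vis α.co) q) (not_dead_of_step hr) u).2 hu
      exact ⟨y, ⟨r, hr⟩, _, .fLeft _ hw, (bisim_par_left hu').trans h⟩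
    · have := card_le_one_of_alive (α := α) hu I fun i hi => by
        obtain ⟨r, hr, h⟩ := hI i hi
        cases hr with
        | fLeft _ _ => exact ⟨_, h⟩
      omega

/-- The invariant for an instance of a small term is witnessed by the effect of adding a summand
to the value of some variable. -/
theorem Exposes.exists_var (hα : α ∈ C) (σ : ℕ → Proc) (t : Term ℕ) (hn : t.size < n)
    (h : Exposes C α n (t.subst σ)) :
    (∃ y, Exposes C α n (σ y) ∧
      ∃ w, Step C (t.subst (addSummand σ y (.pre (.vis α.co) .zero))) (.vis α.co) w ∧
        Dead C w) ∨
    ∃ y, (∃ r, Step C (σ y) (.vis α.co) r) ∧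
      ∃ w, Step C (t.subst (addSummand σ y (.pre (.vis α.co) (.pre (.vis α.co) .zero)))) .tau w ∧
        Bisim C w (.pre (.vis α.co) .zero) := by
  induction t with
  | zero => exact h.elim
  | var y =>
    refine .inl ⟨y, h, .zero, ?_, dead_zero⟩
    rw [subst, addSummand_self]
    exact .plusRight _ (.pre _ _)
  | pre μ t _ => exact h.elim
  | plus t u iht ihu =>
    simp only [size] at hn
    rcases h with h | h
    · rcases iht (by omega) h with ⟨y, hy, w, hw, h⟩ | ⟨y, hy, w, hw, h⟩
      · exact .inl ⟨y, hy, w, .plusLeft _ hw, h⟩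
      · exact .inr ⟨y, hy, w, .plusLeft _ hw, h⟩
    · rcases ihu (by omega) h with ⟨y, hy, w, hw, h⟩ | ⟨y, hy, w, hw, h⟩
      · exact .inl ⟨y, hy, w, .plusRight _ hw, h⟩
      · exact .inr ⟨y, hy, w, .plusRight _ hw, h⟩
  | par t u iht ihu =>
    simp only [size] at hn
    rcases h with ⟨hd, h⟩ | ⟨hd, h⟩
    · rcases ihu (by omega) h with ⟨y, hy, w, hw, h⟩ | ⟨y, ⟨r, hr⟩, w, hw, h⟩
      · have hd' := (dead_addSummand_iff (.pre (.vis α.co) .zero) hy.not_dead t).2 hd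
        exact .inl ⟨y, hy, _, .parRight _ hw, dead_par.2 ⟨hd', h⟩⟩
      · have hd' := (dead_addSummand_iff (.pre (.vis α.co) (.pre (.vis α.co) .zero))
          (not_dead_of_step hr) t).2 hd
        exact .inr ⟨y, ⟨r, hr⟩, _, .parRight _ hw, (bisim_par_right hd').trans h⟩
    · rcases iht (by omega) h with ⟨y, hy, w, hw, h⟩ | ⟨y, ⟨r, hr⟩, w, hw, h⟩
      · have hd' := (dead_addSummand_iff (.pre (.vis α.co) .zero) hy.not_dead u).2 hd
        exact .inl ⟨y, hy, _, .parLeft _ hw, dead_par.2 ⟨h, hd'⟩⟩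
      · have hd' := (dead_addSummand_iff (.pre (.vis α.co) (.pre (.vis α.co) .zero))
          (not_dead_of_step hr) u).2 hd
        exact .inr ⟨y, ⟨r, hr⟩, _, .parLeft _ hw, (bisim_par_left hd').trans h⟩
  | f t u iht _ =>
    simp only [size] at hn
    rcases h with ⟨hd, h⟩ | ⟨h1, h2⟩
    · rcases iht (by omega) h with ⟨y, hy, w, hw, h⟩ | ⟨y, ⟨r, hr⟩, w, hw, h⟩
      · have hd' := (dead_addSummand_iff (.pre (.vis α.co) .zero) hy.not_dead u).2 hd
        exact .inl ⟨y, hy, _, .fLeft _ hw, dead_par.2 ⟨h, hd'⟩⟩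
      · have hd' := (dead_addSummand_iff (.pre (.vis α.co) (.pre (.vis α.co) .zero))
          (not_dead_of_step hr) u).2 hd
        exact .inr ⟨y, ⟨r, hr⟩, _, .fLeft _ hw, (bisim_par_left hd').trans h⟩
    -- All `n + 1` derivatives of `p_n` are used, against the bound `u.size + 1 < n + 1`.
    · obtain ⟨y, ⟨r, hr⟩, w, hw, h⟩ := exists_contributing_var (C := C) (α := α) σ u
        (Finset.range (n + 1)) (fun i hi => by
          obtain ⟨s, hs, hb⟩ := h2.symm.step
            (step_pn_iff.2 ⟨rfl, i, Nat.lt_succ_iff.1 (Finset.mem_range.1 hi), rfl⟩)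
          exact ⟨s, hs, hb.symm⟩)
        (by rw [Finset.card_range]; omega) (.pre (.vis α.co) .zero)
      obtain ⟨s, hs, hd⟩ := step_bisim_pre_zero h1
      obtain ⟨s', hs', hext⟩ :=
        (enlarges_addSummand σ y (.pre (.vis α.co) (.pre (.vis α.co) .zero)) t).step hs
      -- Since `σ y` can already perform `ᾱ`, the enlargement gives no first step to a process that
      -- had none.
      have hd' : Dead C s' := by
        intro μ v hv
        obtain ⟨v', hv'⟩ := hext.can_step_back hr hv
        exact hd _ _ hv'
      exact .inr ⟨y, ⟨r, hr⟩, _, .fComm hα hs' hw, (bisim_par_right hd').trans h⟩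

theorem SoundEq.exposes (hα : α ∈ C) {t u : Term ℕ} (h : SoundEq C t u) (hn : t.size < n)
    (σ : ℕ → Proc) (hu : Bisim C (u.subst σ) (epsLeft α n)) (ht : Exposes C α n (t.subst σ)) :
    Exposes C α n (u.subst σ) := by
  have hb := BelowEps.of_bisim hu
  rcases ht.exists_var hα σ t hn with ⟨y, hy, w, hw, hd⟩ | ⟨y, ⟨r, hr⟩, w, hw, hd⟩
  · obtain ⟨v, hv, hwv⟩ := (h _).step hw
    exact (enlarges_addSummand σ y _ u).exposes_of_step_dead hy hb.not_co hv (hd.of_bisim hwv.symm)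
  · obtain ⟨v, hv, hwv⟩ := (h _).step hw
    exact (enlarges_addSummand σ y _ u).exposes_of_step_tau hr hb hv (hwv.symm.trans hd)

/-! ### Derivable equations preserve the invariant -/

theorem SoundEq.symm {t u : Term ℕ} (h : SoundEq C t u) : SoundEq C u t := fun σ => (h σ).symm

theorem Term.subst_subst {U V W : Type} (σ : U → Term V) (τ : V → Term W) (t : Term U) :
    (t.subst σ).subst τ = t.subst fun x => (σ x).subst τ := by
  induction t with
  | zero => rfl
  | var x => rfl
  | pre μ t ih => simp [subst, ih]
  | plus t u iht ihu => simp [subst, iht, ihu]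
  | par t u iht ihu => simp [subst, iht, ihu]
  | f t u iht ihu => simp [subst, iht, ihu]

theorem bisim_plus_comm (p q : Proc) : Bisim C (.plus p q) (.plus q p) := by
  refine .of_steps ?_ ?_ <;>
  · intro μ r hs
    refine ⟨r, ?_, .refl r⟩
    cases hs with
    | plusLeft _ hs => exact .plusRight _ hs
    | plusRight _ hs => exact .plusLeft _ hs

theorem bisim_plus_assoc (p q r : Proc) :
    Bisim C (.plus (.plus p q) r) (.plus p (.plus q r)) := by
  refine .of_steps (fun μ s hs => ⟨s, ?_, .refl s⟩) fun μ s hs => ⟨s, ?_, .refl s⟩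
  · cases hs with
    | plusLeft _ hs =>
      cases hs with
      | plusLeft _ hs => exact .plusLeft _ hs
      | plusRight _ hs => exact .plusRight _ (.plusLeft _ hs)
    | plusRight _ hs => exact .plusRight _ (.plusRight _ hs)
  · cases hs with
    | plusLeft _ hs => exact .plusLeft _ (.plusLeft _ hs)
    | plusRight _ hs =>
      cases hs with
      | plusLeft _ hs => exact .plusLeft _ (.plusRight _ hs)
      | plusRight _ hs => exact .plusRight _ hs

theorem Derives.sound {E : Set (Term ℕ × Term ℕ)} (hE : ∀ e ∈ E, SoundEq C e.1 e.2)
    {t u : Term ℕ} (h : Derives E t u) : SoundEq C t u := by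
  induction h with
  | ax h => exact hE _ h
  | refl t => exact fun σ => .refl _
  | symm _ ih => exact ih.symm
  | trans _ _ ih1 ih2 => exact fun σ => (ih1 σ).trans (ih2 σ)
  | subst τ _ ih =>
    intro σ
    rw [subst_subst, subst_subst]
    exact ih _
  | pre μ _ ih => exact fun σ => (ih σ).pre μ
  | plus _ _ ih1 ih2 => exact fun σ => (ih1 σ).plus (ih2 σ)
  | par _ _ ih1 ih2 => exact fun σ => (ih1 σ).par (ih2 σ)
  | f _ _ ih1 ih2 => exact fun σ => (ih1 σ).f (ih2 σ)
  | comm t u => exact fun σ => bisim_plus_comm _ _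
  | assoc t u v => exact fun σ => bisim_plus_assoc _ _ _

/-- In closed instances bisimilar to `f(α, p_n)`, the invariant passes from the left-hand side of
the equation to the right-hand side. -/
def Preserves (C : Set Name) (α : Name) (n : ℕ) (t u : Term ℕ) : Prop :=
  ∀ σ : ℕ → Proc, Bisim C (u.subst σ) (epsLeft α n) →
    Exposes C α n (t.subst σ) → Exposes C α n (u.subst σ)

/-- Bisimilarity with `f(α, p_n)` is given for the whole sum only. The exposing summand inherits it
by `Exposes.bisim`: the sum bounds its steps from above, the invariant from below. -/
theorem Preserves.plus {t u t' u' : Term ℕ} (hs : SoundEq C t u) (hs' : SoundEq C t' u')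
    (h : Preserves C α n t u) (h' : Preserves C α n t' u') :
    Preserves C α n (.plus t t') (.plus u u') := by
  intro σ hσ hG
  have hσ' : Bisim C ((Term.plus t t').subst σ) (epsLeft α n) := ((hs σ).plus (hs' σ)).trans hσ
  rcases hG with hG | hG
  · exact .inl (h σ ((hs σ).symm.trans (hG.bisim hσ' fun _ _ h => .plusLeft _ h)) hG)
  · exact .inr (h' σ ((hs' σ).symm.trans (hG.bisim hσ' fun _ _ h => .plusRight _ h)) hG)

theorem Preserves.par {t u t' u' : Term ℕ} (hs : SoundEq C t u) (hs' : SoundEq C t' u')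
    (h : Preserves C α n t u) (h' : Preserves C α n t' u') :
    Preserves C α n (.par t t') (.par u u') := by
  rintro σ hσ (⟨hd, hG⟩ | ⟨hd, hG⟩)
  · have hd' := hd.of_bisim (hs σ).symm
    exact .inl ⟨hd', h' σ ((bisim_par_right hd').symm.trans hσ) hG⟩
  · have hd' := hd.of_bisim (hs' σ).symm
    exact .inr ⟨hd', h σ ((bisim_par_left hd').symm.trans hσ) hG⟩

theorem Preserves.f {t u t' u' : Term ℕ} (hs : SoundEq C t u) (hs' : SoundEq C t' u')
    (h : Preserves C α n t u) : Preserves C α n (.f t t') (.f u u') := by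
  rintro σ hσ (⟨hd, hG⟩ | ⟨h1, h2⟩)
  · have hd' := hd.of_bisim (hs' σ).symm
    exact .inl ⟨hd', h σ ((bisim_f_left hd').symm.trans hσ) hG⟩
  · exact .inr ⟨(hs σ).symm.trans h1, (hs' σ).symm.trans h2⟩

/-- Both directions are carried along because of the symmetry rule. The size bound enters only at
the axioms. -/
theorem Derives.preserves (hα : α ∈ C) {E : Set (Term ℕ × Term ℕ)}
    (hE : ∀ e ∈ E, SoundEq C e.1 e.2) (hn : ∀ e ∈ E, e.1.size < n ∧ e.2.size < n)
    {t u : Term ℕ} (h : Derives E t u) : Preserves C α n t u ∧ Preserves C α n u t := by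
  induction h with
  | ax h =>
    exact ⟨(hE _ h).exposes hα (hn _ h).1, (hE _ h).symm.exposes hα (hn _ h).2⟩
  | refl t => exact ⟨fun _ _ h => h, fun _ _ h => h⟩
  | symm _ ih => exact ih.symm
  | trans h1 h2 ih1 ih2 =>
    exact ⟨fun σ hσ hG => ih2.1 σ hσ (ih1.1 σ ((h2.sound hE σ).trans hσ) hG),
      fun σ hσ hG => ih1.2 σ hσ (ih2.2 σ ((h1.sound hE σ).symm.trans hσ) hG)⟩
  | subst τ _ ih =>
    refine ⟨fun σ => ?_, fun σ => ?_⟩ <;> rw [subst_subst, subst_subst]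
    exacts [ih.1 _, ih.2 _]
  | pre μ _ _ => exact ⟨fun _ _ h => h.elim, fun _ _ h => h.elim⟩
  | plus h1 h2 ih1 ih2 =>
    exact ⟨ih1.1.plus (h1.sound hE) (h2.sound hE) ih2.1,
      ih1.2.plus (h1.sound hE).symm (h2.sound hE).symm ih2.2⟩
  | par h1 h2 ih1 ih2 =>
    exact ⟨ih1.1.par (h1.sound hE) (h2.sound hE) ih2.1,
      ih1.2.par (h1.sound hE).symm (h2.sound hE).symm ih2.2⟩
  | f h1 h2 ih1 _ =>
    exact ⟨ih1.1.f (h1.sound hE) (h2.sound hE), ih1.2.f (h1.sound hE).symm (h2.sound hE).symm⟩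
  | comm t u => exact ⟨fun _ _ h => Or.symm h, fun _ _ h => Or.symm h⟩
  | assoc t u v => exact ⟨fun _ _ h => or_assoc.1 h, fun _ _ h => or_assoc.2 h⟩

/-! ### The two sides of `ε_n` and the conclusion -/

theorem exposes_epsLeft (n : ℕ) : Exposes C α n (epsLeft α n) := .inr ⟨.refl _, .refl _⟩

theorem not_exposes_sum {l : List Proc} (hl : ∀ t ∈ l, ¬ Exposes C α n t) :
    ¬ Exposes C α n (sum l) := by
  induction l with
  | nil => exact fun h => h
  | cons t l ih =>
    cases l with
    | nil => exact hl t (by simp)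
    | cons u l =>
      rintro (h | h)
      · exact hl t (by simp) h
      · exact ih (fun s hs => hl s (List.mem_cons_of_mem _ hs)) h

theorem not_exposes_epsRight (n : ℕ) : ¬ Exposes C α n (epsRight α n) := by
  rintro (h | h)
  · exact h
  · refine not_exposes_sum (fun t ht => ?_) h
    obtain ⟨i, _, rfl⟩ := List.mem_map.1 ht
    exact fun h => h

theorem mainTheorem5 (C : Set Name) (α : Name) (hα : α ∈ C)
    (E : Set (Term ℕ × Term ℕ)) (hfin : E.Finite)
    (hsound : ∀ e ∈ E, SoundEq C e.1 e.2)
    (n : ℕ) (hn : ∀ e ∈ E, e.1.size < n ∧ e.2.size < n) :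
    (∀ p q : Proc,
      Bisim C p (Term.epsLeft α n) → Bisim C q (Term.epsLeft α n) →
      Derives E p.lift q.lift →
      (∃ r ∈ p.summands, Bisim C r (Term.epsLeft α n) ∧ ¬ HasZeroFactor C r) →
      ∃ r ∈ q.summands, Bisim C r (Term.epsLeft α n)) ∧
    SoundEq C (Term.epsLeft α n) (Term.epsRight α n) ∧
    ¬ Derives E (Term.epsLeft α n) (Term.epsRight α n) := by
  refine ⟨?_, fun σ => ?_, fun h => ?_⟩
  · rintro p q - hq hd ⟨r, hr, hre, h0⟩
    -- Any closed substitution would do, since lifted processes contain no variables.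
    have h := (hd.preserves hα hsound hn).1 fun _ => .zero
    rw [subst_lift, subst_lift] at h
    obtain ⟨s, hs, hG⟩ := (h hq (exposes_of_mem_summands hα hr hre h0)).exists_summand
    exact ⟨s, hs, hG.bisim hq fun _ _ => step_of_mem_summands hs⟩
  · rw [subst_epsLeft, subst_epsRight]
    exact epsLeft_bisim_epsRight hα n
  · have h := (h.preserves hα hsound hn).1 fun _ => .zero
    rw [subst_epsLeft, subst_epsRight] at h
    exact not_exposes_epsRight n
      (h (epsLeft_bisim_epsRight hα n).symm (exposes_epsLeft n))
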